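/- Let $p\ge 0$ be an integer and let $SO(p)$ carry the bi-invariant Riemannian metric whose value at the identity $I$ is $(A_1,A_2)\mapsto-\tfrac12\operatorname{tr}(A_1A_2)$ on antisymmetric $p\times p$ matrices; let $d_{SO}$ be its geodesic distance (the infimum of the lengths of $C^1$ curves in $SO(p)$ joining two points). An involution is an element $R\in SO(p)$ with $R^2=I\ne R$, and $\operatorname{level}(R)$ is the dimension of its $(-1)$-eigenspace. For $\sigma=(\sigma_1,\dots,\sigma_p)\in\{1,-1\}^p$ let $I_\sigma=\operatorname{diag}(\sigma_1,\dots,\sigma_p)$ and $\operatorname{level}(\sigma)=\#\{i:\sigma_i=-1\}$; $\sigma$ is an even sign change if $I_\sigma\in SO(p)$. Proposition. Let $R\in SO(p)$ be an involution with $\operatorname{level}(R)\ge\frac12p$. Then there exists an even sign change $\sigma$ with $\operatorname{level}(\sigma)=\operatorname{level}(R)$ such that $d_{SO}(RI_\sigma,I)<d_{SO}(R,I)$. -/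

import Mathlib

namespace SignChange

noncomputable section

/-- The rotation group `SO(p)`. -/
abbrev SO (p : ℕ) : Type := Matrix.specialOrthogonalGroup (Fin p) ℝ

/-- An involution of `SO(p)`: an element `R` with `R² = I` and `R ≠ I`. -/
def IsInvolution {p : ℕ} (R : SO p) : Prop := R * R = 1 ∧ R ≠ 1

/-- The level of `R`: the dimension of its `(-1)`-eigenspace in `ℝ^p`. -/
def level {p : ℕ} (R : SO p) : ℕ :=
  Module.finrank ℝ
    (Module.End.eigenspace (Matrix.toLin' (R : Matrix (Fin p) (Fin p) ℝ)) (-1))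

/-- The diagonal matrix `I_σ` with diagonal entries `σ₁, …, σ_p ∈ {1, -1}`. -/
def signMatrix {p : ℕ} (σ : Fin p → ℤˣ) : Matrix (Fin p) (Fin p) ℝ :=
  Matrix.diagonal fun i => (((σ i : ℤˣ) : ℤ) : ℝ)

/-- The level of a sign change `σ`: the number of indices `i` with `σ i = -1`. -/
def signLevel {p : ℕ} (σ : Fin p → ℤˣ) : ℕ :=
  (Finset.univ.filter fun i => σ i = -1).card

/-- `σ` is an even sign change: the matrix `I_σ` lies in `SO(p)`. -/
def IsEven {p : ℕ} (σ : Fin p → ℤˣ) : Prop :=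
  signMatrix σ ∈ Matrix.specialOrthogonalGroup (Fin p) ℝ

/-- The set of even sign changes. -/
abbrev EvenSignChange (p : ℕ) : Type := {σ : Fin p → ℤˣ // IsEven σ}

/-- The element `I_σ` of `SO(p)` given by an even sign change. -/
def signSO {p : ℕ} (σ : EvenSignChange p) : SO p := ⟨signMatrix σ.1, σ.2⟩

/-- The bi-invariant Riemannian metric of `SO(p)` that is `(A, B) ↦ -½ tr (A B)` at the identity,
where the tangent space is the space of antisymmetric matrices.  At `U` the tangent space is
`{U A | A antisymmetric}`, and tangent vectors are carried to the identity by left translation. -/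
def soMetric {p : ℕ} (U X Y : Matrix (Fin p) (Fin p) ℝ) : ℝ :=
  -(1 / 2) * Matrix.trace ((U⁻¹ * X) * (U⁻¹ * Y))

/-- `γ`, restricted to `[0,1]`, is a `C¹` curve in `SO(p)` from `U` to `V`
(`SO(p)` is an embedded submanifold of the space of matrices). -/
structure IsC1Curve {p : ℕ} (U V : SO p) (γ : ℝ → Matrix (Fin p) (Fin p) ℝ) : Prop where
  mem : ∀ t ∈ Set.Icc (0 : ℝ) 1, γ t ∈ Matrix.specialOrthogonalGroup (Fin p) ℝ
  smooth : ∀ i j, ContDiffOn ℝ 1 (fun t => γ t i j) (Set.Icc 0 1)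
  start : γ 0 = U
  finish : γ 1 = V

/-- The velocity, at `t ∈ [0,1]`, of a curve of matrices. -/
def velocity {p : ℕ} (γ : ℝ → Matrix (Fin p) (Fin p) ℝ) (t : ℝ) : Matrix (Fin p) (Fin p) ℝ :=
  Matrix.of fun i j => derivWithin (fun s => γ s i j) (Set.Icc 0 1) t

/-- The Riemannian length of a curve in `SO(p)` parametrized by `[0,1]`. -/
def curveLength {p : ℕ} (γ : ℝ → Matrix (Fin p) (Fin p) ℝ) : ℝ :=
  ∫ t in (0 : ℝ)..1, Real.sqrt (soMetric (γ t) (velocity γ t) (velocity γ t))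

/-- The geodesic distance of `SO(p)`: the infimum of the lengths of the `C¹` curves from `U` to `V`.
Such curves exist because `SO(p)` is connected. -/
def dSO {p : ℕ} (U V : SO p) : ℝ :=
  sInf {l : ℝ | ∃ γ : ℝ → Matrix (Fin p) (Fin p) ℝ, IsC1Curve U V γ ∧ curveLength γ = l}

end

end SignChange

/-!
Let `m = level R`. Then `R = 1 - 2 P`, where `P` is the orthogonal projection to the
`(-1)`-eigenspace of `R`, of rank `m`, and a sign change of level `m` is `I_σ = 1 - 2 Q`, where `Q`
is the orthogonal projection to the span of `m` coordinate vectors. Both distances are compared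
with `π √(m / 2)`.

Lower bound `π √(m / 2) ≤ d(R, 1)` (`IsInvolution.le_dSO`). Along a curve from `R` to `1`, each of
`m` orthonormal vectors of the `(-1)`-eigenspace travels on the unit sphere to its antipode, hence
a distance of at least `π`. By the Cauchy-Schwarz inequality the sum of these `m` distances is at
most `√(2 m)` times the Riemannian length of the curve (`pi_mul_sqrt_le_curveLength`).

Upper bound for `d(R I_σ, 1)` (`dSO_mul_lt`). Let `θ₁, …, θₘ` be the principal angles between the
ranges of `P` and `Q`. Moving the range of `P` to that of `Q` along a geodesic of the Grassmannian
yields a curve from `R I_σ` to `1` of length `2 √(∑ θᵢ²)` (`exists_curve_of_frames`). By Jordan's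
inequality `2 θ ≤ π sin θ`, the square of this length is at most
`π² ∑ sin² θᵢ = π² (m - tr (P Q))`, and strictly less unless every `θᵢ` is `0` or `π / 2`, in which
case `P` and `Q` commute. So it is enough that `tr (P Q) ≥ m / 2`, where in the case of equality `P`
and `Q` must not commute.

Choice of `σ` (`exists_coordProj`). The trace of `P Q` is the sum of the diagonal entries of `P` at
the chosen `m` coordinates. Since `p ≤ 2 m` and `tr P = m`, if no choice exceeded `m / 2`, all
choices would give exactly `m / 2`. If moreover `P` commuted with every `Q`, it would be diagonal,
hence equal to one of the `Q`, for which `tr (P Q) = m`.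
-/

namespace SignChange

open Matrix

/-! ### Orthonormal frames and principal vectors -/

theorem of_orthonormal_transpose_mul_self {m n : Type*} [Fintype m] [Fintype n] [DecidableEq n]
    {b : n → EuclideanSpace ℝ m} (hb : Orthonormal ℝ b) :
    (Matrix.of fun k i => b i k)ᵀ * (Matrix.of fun k i => b i k) = (1 : Matrix n n ℝ) := by
  ext i j
  have h := orthonormal_iff_ite.mp hb i j
  rw [PiLp.inner_apply] at h
  simp only [Matrix.mul_apply, Matrix.transpose_apply, Matrix.of_apply, Matrix.one_apply, ← h]
  exact Finset.sum_congr rfl fun k _ => by simp [mul_comm]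

/-- Singular value decomposition of a square matrix. If the columns of `A` are eigenvectors of `M Mᵀ`,
the rows of `Aᵀ M` are orthogonal; the nonzero ones are normalized and completed to an orthonormal
basis, which gives the columns of `B`. -/
theorem exists_singularValueDecomposition {n : Type*} [Fintype n] [DecidableEq n]
    (M : Matrix n n ℝ) :
    ∃ (A B : Matrix n n ℝ) (c : n → ℝ), Aᵀ * A = 1 ∧ Bᵀ * B = 1 ∧ (∀ i, 0 ≤ c i) ∧
      Aᵀ * M * B = diagonal c := by
  have hH : (M * Mᵀ).IsHermitian := by
    rw [Matrix.IsHermitian, conjTranspose_eq_transpose_of_trivial]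
    simp
  set A : Matrix n n ℝ := (hH.eigenvectorUnitary : Matrix n n ℝ) with hA
  have hAA : Aᵀ * A = 1 := by
    have := Unitary.coe_star_mul_self hH.eigenvectorUnitary
    rwa [star_eq_conjTranspose, conjTranspose_eq_transpose_of_trivial] at this
  have hspec : M * Mᵀ = A * diagonal hH.eigenvalues * Aᵀ := by
    have := hH.spectral_theorem
    rw [Unitary.conjStarAlgAut_apply, star_eq_conjTranspose,
      conjTranspose_eq_transpose_of_trivial] at this
    exact this
  set N := Aᵀ * M with hN
  have hNN : N * Nᵀ = diagonal hH.eigenvalues := by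
    calc N * Nᵀ = Aᵀ * (M * Mᵀ) * A := by simp [hN, Matrix.mul_assoc]
      _ = (Aᵀ * A) * diagonal hH.eigenvalues * (Aᵀ * A) := by
        rw [congrArg (fun X => Aᵀ * X * A) hspec]; simp only [Matrix.mul_assoc]
      _ = _ := by simp [hAA]
  have hrow : ∀ i j, ∑ k, N i k * N j k = if i = j then hH.eigenvalues i else 0 := by
    intro i j
    have := congrFun (congrFun hNN i) j
    rwa [Matrix.mul_apply, Matrix.diagonal_apply] at this
  have hnn : ∀ i, 0 ≤ hH.eigenvalues i := fun i => by
    rw [← if_pos (rfl : i = i) (α := ℝ) (t := hH.eigenvalues i) (e := 0), ← hrow i i]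
    exact Finset.sum_nonneg fun k _ => mul_self_nonneg _
  set v : n → EuclideanSpace ℝ n :=
    fun i => WithLp.toLp 2 fun k => (√(hH.eigenvalues i))⁻¹ * N i k with hv
  have hvo : Orthonormal ℝ ({i | hH.eigenvalues i ≠ 0}.domRestrict v) := by
    rw [orthonormal_iff_ite]
    rintro ⟨i, hi⟩ ⟨j, hj⟩
    have hi' : √(hH.eigenvalues i) ≠ 0 := (Real.sqrt_pos.2 ((hnn i).lt_of_ne' hi)).ne'
    simp only [Set.domRestrict_apply, PiLp.inner_apply, hv, Subtype.mk.injEq]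
    have : ∑ k, inner ℝ ((√(hH.eigenvalues i))⁻¹ * N i k) ((√(hH.eigenvalues j))⁻¹ * N j k)
        = (√(hH.eigenvalues i))⁻¹ * (√(hH.eigenvalues j))⁻¹ * ∑ k, N i k * N j k := by
      rw [Finset.mul_sum]
      refine Finset.sum_congr rfl fun k _ => ?_
      simp only [RCLike.inner_apply, conj_trivial]
      ring
    rw [this, hrow]
    split_ifs with hij
    · subst hij
      field_simp
      exact (Real.sq_sqrt (hnn i)).symm
    · simp
  obtain ⟨b, hb⟩ := hvo.exists_orthonormalBasis_extension_of_card_eq (by simp)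
  have hNb : ∀ i k, N i k = √(hH.eigenvalues i) * b i k := by
    intro i k
    by_cases hi : hH.eigenvalues i = 0
    · have h0 := hrow i i
      rw [if_pos rfl, hi, Finset.sum_eq_zero_iff_of_nonneg fun k _ => mul_self_nonneg _] at h0
      simpa [hi] using h0 k (Finset.mem_univ k)
    · have hi' : √(hH.eigenvalues i) ≠ 0 := (Real.sqrt_pos.2 ((hnn i).lt_of_ne' hi)).ne'
      rw [hb i hi]
      simp [hv, hi']
  have hBB := of_orthonormal_transpose_mul_self b.orthonormal
  refine ⟨A, Matrix.of fun k i => b i k, fun i => √(hH.eigenvalues i), hAA, hBB,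
    fun i => Real.sqrt_nonneg _, ?_⟩
  have : N = diagonal (fun i => √(hH.eigenvalues i)) * (Matrix.of fun k i => b i k)ᵀ := by
    ext i k
    simp [Matrix.diagonal_mul, hNb]
  rw [← hN, this, Matrix.mul_assoc, hBB, Matrix.mul_one]

/-- An orthogonal projection is `U Uᵀ`, where the columns of `U` are an orthonormal basis of its
range. -/
theorem exists_frame_of_projection {n : Type*} [Fintype n] [DecidableEq n] {P : Matrix n n ℝ}
    (hsymm : Pᵀ = P) (hidem : P * P = P) {m : ℕ} (hrank : P.rank = m) :
    ∃ U : Matrix n (Fin m) ℝ, Uᵀ * U = 1 ∧ U * Uᵀ = P := by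
  subst hrank
  let W : Submodule ℝ (EuclideanSpace ℝ n) := (Matrix.toEuclideanLin P).range
  have hW : Module.finrank ℝ W = P.rank := (P.rank_eq_finrank_range_toLin
    (EuclideanSpace.basisFun n ℝ).toBasis (EuclideanSpace.basisFun n ℝ).toBasis).symm ▸ by
      rfl
  let b := (stdOrthonormalBasis ℝ W).reindex (finCongr hW)
  have hbo : Orthonormal ℝ fun i => (b i : EuclideanSpace ℝ n) :=
    b.orthonormal.comp_linearIsometry W.subtypeₗᵢ
  set U : Matrix n (Fin P.rank) ℝ := Matrix.of fun k i => (b i : EuclideanSpace ℝ n) k with hU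
  have hUU : Uᵀ * U = 1 := of_orthonormal_transpose_mul_self hbo
  have hPU : P * U = U := by
    have hfix : ∀ i, P *ᵥ (b i : EuclideanSpace ℝ n).ofLp = (b i : EuclideanSpace ℝ n).ofLp := by
      intro i
      obtain ⟨y, hy⟩ := (b i).2
      rw [← hy]
      simp [Matrix.toLpLin_apply, hidem]
    ext k i
    exact congrFun (hfix i) k
  have hUP : U * Uᵀ * P = P := by
    ext k l
    let x : W := ⟨Matrix.toEuclideanLin P (EuclideanSpace.single l 1), LinearMap.mem_range_self _ _⟩
    have hx : ∀ k, (x : EuclideanSpace ℝ n) k = P k l := by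
      intro k
      simp [x, Matrix.toLpLin_apply]
    have h := congrArg (fun w : W => (w : EuclideanSpace ℝ n) k) (b.sum_repr' x)
    simp only [hx] at h
    rw [← h, Matrix.mul_assoc, Matrix.mul_apply]
    simp only [Submodule.coe_sum, Submodule.coe_smul, WithLp.ofLp_sum, Finset.sum_apply,
      WithLp.ofLp_smul, Pi.smul_apply, smul_eq_mul, Submodule.coe_inner, PiLp.inner_apply, hx]
    refine Finset.sum_congr rfl fun i _ => ?_
    rw [Matrix.mul_apply, mul_comm]
    congr 1
    refine Finset.sum_congr rfl fun j _ => ?_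
    simp [hU, mul_comm]
  refine ⟨U, hUU, ?_⟩
  have := congrArg Matrix.transpose hUP
  simp only [Matrix.transpose_mul, Matrix.transpose_transpose, hsymm] at this
  calc U * Uᵀ = P * (U * Uᵀ) := by rw [← Matrix.mul_assoc, hPU]
    _ = P := this

/-- Principal vectors of two subspaces of equal dimension, given by their orthogonal projections:
orthonormal bases `U` and `V` of the subspaces that are biorthogonal up to the cosines `c i` of the
principal angles. They come from the singular value decomposition of `U₀ᵀ V₀`, where `U₀` and `V₀`
are any orthonormal bases. -/
theorem exists_principalVectors {n : Type*} [Fintype n] [DecidableEq n] {P Q : Matrix n n ℝ}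
    (hP : Pᵀ = P) (hP' : P * P = P) (hQ : Qᵀ = Q) (hQ' : Q * Q = Q) {m : ℕ}
    (hPm : P.rank = m) (hQm : Q.rank = m) :
    ∃ (U V : Matrix n (Fin m) ℝ) (c : Fin m → ℝ), Uᵀ * U = 1 ∧ U * Uᵀ = P ∧ Vᵀ * V = 1 ∧
      V * Vᵀ = Q ∧ (∀ i, 0 ≤ c i) ∧ Uᵀ * V = diagonal c := by
  obtain ⟨U, hUU, rfl⟩ := exists_frame_of_projection hP hP' hPm
  obtain ⟨V, hVV, rfl⟩ := exists_frame_of_projection hQ hQ' hQm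
  obtain ⟨A, B, c, hA, hB, hc, hAB⟩ := exists_singularValueDecomposition (Uᵀ * V)
  have hconj : ∀ {W : Matrix n (Fin m) ℝ} {C : Matrix (Fin m) (Fin m) ℝ}, Wᵀ * W = 1 →
      Cᵀ * C = 1 → (W * C)ᵀ * (W * C) = 1 ∧ (W * C) * (W * C)ᵀ = W * Wᵀ := by
    intro W C hW hC
    refine ⟨?_, ?_⟩
    · rw [transpose_mul, Matrix.mul_assoc, ← Matrix.mul_assoc Wᵀ, hW, Matrix.one_mul, hC]
    · rw [transpose_mul, Matrix.mul_assoc, ← Matrix.mul_assoc C, mul_eq_one_comm.mp hC,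
        Matrix.one_mul]
  refine ⟨U * A, V * B, c, (hconj hUU hA).1, (hconj hUU hA).2, (hconj hVV hB).1,
    (hconj hVV hB).2, hc, ?_⟩
  rw [← hAB, transpose_mul]
  simp only [Matrix.mul_assoc]

/-! ### Curves in the rotation group -/

/-- The product rule for matrices, in terms of entries, so that no norm on matrices is involved. -/
theorem hasDerivWithinAt_mul_apply {l m n : Type*} [Fintype m] {A : ℝ → Matrix l m ℝ}
    {B : ℝ → Matrix m n ℝ} {A' : Matrix l m ℝ} {B' : Matrix m n ℝ} {s : Set ℝ} {t : ℝ}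
    (hA : ∀ i j, HasDerivWithinAt (fun x => A x i j) (A' i j) s t)
    (hB : ∀ i j, HasDerivWithinAt (fun x => B x i j) (B' i j) s t) (i : l) (j : n) :
    HasDerivWithinAt (fun x => (A x * B x) i j) ((A' * B t + A t * B') i j) s t := by
  simp only [Matrix.mul_apply, Matrix.add_apply, ← Finset.sum_add_distrib]
  exact HasDerivWithinAt.fun_sum fun k _ => (hA i k).mul (hB k j)

/-- On tangent vectors `Z` at `G`, the metric is half the squared Frobenius norm. -/
theorem soMetric_eq {p : ℕ} {G Z : Matrix (Fin p) (Fin p) ℝ} (hG : Gᵀ * G = 1)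
    (hZ : Zᵀ * G + Gᵀ * Z = 0) : soMetric G Z Z = 1 / 2 * trace (Zᵀ * Z) := by
  have hinv : G⁻¹ = Gᵀ := Matrix.inv_eq_left_inv hG
  have hGG : G * Gᵀ = 1 := mul_eq_one_comm.mp hG
  have : Gᵀ * Z * (Gᵀ * Z) = -(Zᵀ * Z) := by
    rw [show Gᵀ * Z * (Gᵀ * Z) = -(Zᵀ * G) * (Gᵀ * Z) by
      rw [eq_neg_of_add_eq_zero_left hZ, neg_neg], Matrix.neg_mul, Matrix.mul_assoc Zᵀ,
      ← Matrix.mul_assoc G, hGG, Matrix.one_mul]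
  rw [soMetric, hinv, this, trace_neg]
  ring

section Curves

variable {p : ℕ} {S T : SO p} {γ : ℝ → Matrix (Fin p) (Fin p) ℝ}

theorem IsC1Curve.transpose_mul_self (h : IsC1Curve S T γ) {t : ℝ} (ht : t ∈ Set.Icc (0 : ℝ) 1) :
    (γ t)ᵀ * γ t = 1 :=
  (mem_orthogonalGroup_iff' (Fin p) ℝ).mp (mem_specialOrthogonalGroup_iff.mp (h.mem t ht)).1

theorem IsC1Curve.hasDerivWithinAt (h : IsC1Curve S T γ) {t : ℝ} (ht : t ∈ Set.Icc (0 : ℝ) 1)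
    (i j : Fin p) :
    HasDerivWithinAt (fun s => γ s i j) (velocity γ t i j) (Set.Icc 0 1) t :=
  ((h.smooth i j).differentiableOn one_ne_zero t ht).hasDerivWithinAt

theorem IsC1Curve.velocity_antisymm (h : IsC1Curve S T γ) {t : ℝ} (ht : t ∈ Set.Icc (0 : ℝ) 1) :
    (velocity γ t)ᵀ * γ t + (γ t)ᵀ * velocity γ t = 0 := by
  ext i j
  have h1 := hasDerivWithinAt_mul_apply (A := fun s => (γ s)ᵀ) (A' := (velocity γ t)ᵀ)
    (fun i j => h.hasDerivWithinAt ht j i) (h.hasDerivWithinAt ht) i j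
  have h2 : HasDerivWithinAt (fun s => ((γ s)ᵀ * γ s) i j) 0 (Set.Icc 0 1) t :=
    (hasDerivWithinAt_const t _ ((1 : Matrix (Fin p) (Fin p) ℝ) i j)).congr
      (fun s hs => by rw [h.transpose_mul_self hs]) (by rw [h.transpose_mul_self ht])
  exact (uniqueDiffOn_Icc zero_lt_one t ht).eq_deriv _ h1 h2

theorem IsC1Curve.soMetric_velocity (h : IsC1Curve S T γ) {t : ℝ} (ht : t ∈ Set.Icc (0 : ℝ) 1) :
    soMetric (γ t) (velocity γ t) (velocity γ t)
      = 1 / 2 * trace ((velocity γ t)ᵀ * velocity γ t) :=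
  soMetric_eq (h.transpose_mul_self ht) (h.velocity_antisymm ht)

theorem IsC1Curve.continuousOn_speed (h : IsC1Curve S T γ) :
    ContinuousOn (fun t => √(soMetric (γ t) (velocity γ t) (velocity γ t))) (Set.Icc 0 1) := by
  have hv : ∀ i j, ContinuousOn (fun t => velocity γ t i j) (Set.Icc 0 1) := fun i j =>
    (h.smooth i j).continuousOn_derivWithin (uniqueDiffOn_Icc zero_lt_one) le_rfl
  have : ContinuousOn (fun t => √(1 / 2 * trace ((velocity γ t)ᵀ * velocity γ t)))
      (Set.Icc 0 1) := by
    simp only [trace, diag, Matrix.mul_apply, transpose_apply]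
    refine (continuousOn_const.mul ?_).sqrt
    exact continuousOn_finsetSum _ fun i _ => continuousOn_finsetSum _ fun k _ =>
      (hv k i).mul (hv k i)
  exact this.congr fun t ht => by simp only [h.soMetric_velocity ht]

theorem curveLength_nonneg (γ : ℝ → Matrix (Fin p) (Fin p) ℝ) : 0 ≤ curveLength γ :=
  intervalIntegral.integral_nonneg zero_le_one fun _ _ => Real.sqrt_nonneg _

theorem dSO_le_curveLength (h : IsC1Curve S T γ) : dSO S T ≤ curveLength γ :=
  csInf_le ⟨0, by rintro _ ⟨γ, -, rfl⟩; exact curveLength_nonneg γ⟩ ⟨γ, h, rfl⟩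

end Curves

/-! ### The lower bound for the length of a curve -/

/-- An infinitesimal form of the fact that the angle between `u` and `γ u` grows at most as fast as
`γ u` moves on the unit sphere. The factor `r < 1` keeps the derivative of `arcsin` finite where
`u` and `G u` are parallel. -/
theorem arcsin_deriv_bound {n : Type*} [Fintype n] [DecidableEq n] {G Z : Matrix n n ℝ}
    (hG : Gᵀ * G = 1) (hZ : Zᵀ * G + Gᵀ * Z = 0) {u : n → ℝ} (hu : u ⬝ᵥ u = 1) {r : ℝ}
    (hr0 : 0 ≤ r) (hr1 : r < 1) :
    (u ⬝ᵥ G *ᵥ u) ^ 2 ≤ 1 ∧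
      1 / √(1 - (r * (u ⬝ᵥ G *ᵥ u)) ^ 2) * (r * (u ⬝ᵥ Z *ᵥ u)) ≤ √(Z *ᵥ u ⬝ᵥ Z *ᵥ u) := by
  set y := G *ᵥ u with hy
  set z := Z *ᵥ u with hz
  have cauchy : ∀ a b : n → ℝ, (a ⬝ᵥ b) ^ 2 ≤ (a ⬝ᵥ a) * (b ⬝ᵥ b) := fun a b => by
    simpa only [dotProduct, sq] using Finset.sum_mul_sq_le_sq_mul_sq Finset.univ a b
  have hyy : y ⬝ᵥ y = 1 := by
    rw [hy, dotProduct_mulVec, vecMul_mulVec, hG, vecMul_one, hu]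
  have hzy : z ⬝ᵥ y = 0 := by
    have h1 : z ⬝ᵥ y = u ⬝ᵥ (Zᵀ * G) *ᵥ u := by
      rw [hz, hy, dotProduct_mulVec, vecMul_mulVec, dotProduct_mulVec]
    have h2 : y ⬝ᵥ z = u ⬝ᵥ (Gᵀ * Z) *ᵥ u := by
      rw [hz, hy, dotProduct_mulVec, vecMul_mulVec, dotProduct_mulVec]
    have h3 : z ⬝ᵥ y + y ⬝ᵥ z = 0 := by
      rw [h1, h2, ← dotProduct_add, ← add_mulVec, hZ, zero_mulVec, dotProduct_zero]
    rw [dotProduct_comm y z] at h3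
    linarith
  set x := u ⬝ᵥ y with hx
  have hx1 : x ^ 2 ≤ 1 := by simpa [hu, hyy] using cauchy u y
  refine ⟨hx1, ?_⟩
  have huz : (u ⬝ᵥ z) ^ 2 ≤ (1 - x ^ 2) * (z ⬝ᵥ z) := by
    have h := cauchy (u - x • y) z
    have e1 : (u - x • y) ⬝ᵥ z = u ⬝ᵥ z := by
      rw [sub_dotProduct, smul_dotProduct, dotProduct_comm y z, hzy]; simp
    have e2 : (u - x • y) ⬝ᵥ (u - x • y) = 1 - x ^ 2 := by
      simp only [sub_dotProduct, dotProduct_sub, smul_dotProduct, dotProduct_smul, hu, hyy,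
        dotProduct_comm y u, ← hx, smul_eq_mul]
      ring
    rwa [e1, e2] at h
  have hzz : 0 ≤ z ⬝ᵥ z := dotProduct_self_star_nonneg z
  have hr2 : r ^ 2 < 1 := by nlinarith
  have hpos : 0 < 1 - (r * x) ^ 2 := by nlinarith [sq_nonneg x, sq_nonneg r]
  rw [one_div, inv_mul_le_iff₀ (Real.sqrt_pos.2 hpos), ← Real.sqrt_mul hpos.le]
  refine Real.le_sqrt_of_sq_le ?_
  calc (r * (u ⬝ᵥ z)) ^ 2 = r ^ 2 * (u ⬝ᵥ z) ^ 2 := by ring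
    _ ≤ r ^ 2 * ((1 - x ^ 2) * (z ⬝ᵥ z)) := by gcongr
    _ = (r ^ 2 * (1 - x ^ 2)) * (z ⬝ᵥ z) := by ring
    _ ≤ (1 - (r * x) ^ 2) * (z ⬝ᵥ z) := by gcongr; nlinarith

/-- Orthonormal vectors that move with `Z` have total speed at most `√(2 m)` times the Riemannian
speed of `Z`, by the Cauchy-Schwarz inequality and `‖Z U‖ ≤ ‖Z‖` for the Frobenius norm. -/
theorem sum_sqrt_le_speed {n m : Type*} [Fintype n] [DecidableEq n] [Fintype m] [DecidableEq m]
    {U : Matrix n m ℝ} (hU : Uᵀ * U = 1) (Z : Matrix n n ℝ) :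
    ∑ j, √(Z *ᵥ U.col j ⬝ᵥ Z *ᵥ U.col j)
      ≤ √(2 * Fintype.card m) * √(1 / 2 * trace (Zᵀ * Z)) := by
  have hsum : ∑ j, (Z *ᵥ U.col j ⬝ᵥ Z *ᵥ U.col j) = trace ((Z * U)ᵀ * (Z * U)) := rfl
  have hpos : ∀ {l : Type _} [Fintype l] (A : Matrix l n ℝ), 0 ≤ trace (A * Aᵀ) := fun A =>
    Finset.sum_nonneg fun i _ => Finset.sum_nonneg fun j _ => mul_self_nonneg _
  have hle : trace ((Z * U)ᵀ * (Z * U)) ≤ trace (Zᵀ * Z) := by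
    have h1 : (1 - U * Uᵀ) * (1 - U * Uᵀ)ᵀ = 1 - U * Uᵀ := by
      have : U * Uᵀ * (U * Uᵀ) = U * Uᵀ := by
        rw [Matrix.mul_assoc, ← Matrix.mul_assoc Uᵀ, hU, Matrix.one_mul]
      simp only [transpose_sub, transpose_one, transpose_mul, transpose_transpose, Matrix.sub_mul,
        Matrix.mul_sub, Matrix.one_mul, Matrix.mul_one, this]
      abel
    have h2 := hpos (Z * (1 - U * Uᵀ))
    rw [transpose_mul, Matrix.mul_assoc, ← Matrix.mul_assoc (1 - U * Uᵀ), h1, Matrix.sub_mul,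
      Matrix.one_mul, Matrix.mul_sub, trace_sub] at h2
    rw [trace_mul_comm (Z * U)ᵀ, trace_mul_comm Zᵀ, transpose_mul]
    simp only [Matrix.mul_assoc] at h2 ⊢
    linarith
  have h0 : ∀ j, 0 ≤ Z *ᵥ U.col j ⬝ᵥ Z *ᵥ U.col j := fun j => dotProduct_self_star_nonneg _
  rw [← Real.sqrt_mul (by positivity)]
  refine Real.le_sqrt_of_sq_le ?_
  have h := sq_sum_le_card_mul_sum_sq (s := Finset.univ)
    (f := fun j => √(Z *ᵥ U.col j ⬝ᵥ Z *ᵥ U.col j))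
  simp only [Real.sq_sqrt (h0 _), hsum, Finset.card_univ] at h
  calc _ ≤ _ := h
    _ ≤ (Fintype.card m : ℝ) * trace (Zᵀ * Z) := by gcongr
    _ = _ := by ring

/-- A curve from an element that is `-1` on an `m`-dimensional subspace to the identity has length at
least `π √(m / 2)`: each vector of an orthonormal basis of that subspace travels on the unit sphere
to its antipode, hence at least the distance `π`. -/
theorem pi_mul_sqrt_le_curveLength {p m : ℕ} {S : SO p}
    {γ : ℝ → Matrix (Fin p) (Fin p) ℝ} (h : IsC1Curve S 1 γ) {U : Matrix (Fin p) (Fin m) ℝ}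
    (hU : Uᵀ * U = 1) (hS : S.1 * U = -U) : Real.pi * √(m / 2) ≤ curveLength γ := by
  have hu : ∀ j, U.col j ⬝ᵥ U.col j = 1 := fun j => by
    have := congrFun (congrFun hU j) j
    rwa [one_apply_eq] at this
  have hstart : ∀ j, U.col j ⬝ᵥ γ 0 *ᵥ U.col j = -1 := fun j => by
    have : γ 0 *ᵥ U.col j = -U.col j := by
      rw [h.start]
      ext i
      exact congrFun (congrFun hS i) j
    rw [this, dotProduct_neg, hu]
  have hend : ∀ j, U.col j ⬝ᵥ γ 1 *ᵥ U.col j = 1 := fun j => by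
    rw [h.finish, OneMemClass.coe_one, one_mulVec, hu]
  have hder : ∀ t ∈ Set.Icc (0 : ℝ) 1, ∀ j, HasDerivWithinAt
      (fun s => U.col j ⬝ᵥ γ s *ᵥ U.col j) (U.col j ⬝ᵥ velocity γ t *ᵥ U.col j)
      (Set.Icc 0 1) t := fun t ht j => by
    simp only [dotProduct, mulVec]
    exact HasDerivWithinAt.fun_sum fun k _ => HasDerivWithinAt.const_mul _ <|
      HasDerivWithinAt.fun_sum fun l _ => (h.hasDerivWithinAt ht k l).mul_const _
  -- Each of the `m` functions `arcsin (r * ⟪u, γ u⟫)` grows by `2 * arcsin r`.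
  have key : ∀ r ∈ Set.Ico (0 : ℝ) 1,
      2 * m * Real.arcsin r ≤ √(2 * m) * curveLength γ := by
    rintro r ⟨hr0, hr1⟩
    have hbd := fun t (ht : t ∈ Set.Icc (0 : ℝ) 1) j => arcsin_deriv_bound
      (h.transpose_mul_self ht) (h.velocity_antisymm ht) (hu j) hr0 hr1
    have := intervalIntegral.sub_le_integral_of_hasDeriv_right_of_le (zero_le_one (α := ℝ))
      (g := fun t => ∑ j, Real.arcsin (r * (U.col j ⬝ᵥ γ t *ᵥ U.col j)))
      (g' := fun t => ∑ j, 1 / √(1 - (r * (U.col j ⬝ᵥ γ t *ᵥ U.col j)) ^ 2) *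
        (r * (U.col j ⬝ᵥ velocity γ t *ᵥ U.col j)))
      (φ := fun t => √(2 * m) * √(soMetric (γ t) (velocity γ t) (velocity γ t)))
      (continuousOn_finsetSum _ fun j _ => Real.continuous_arcsin.comp_continuousOn
        (continuousOn_const.mul fun t ht => (hder t ht j).continuousWithinAt))
      (fun t ht => ?_)
      ((continuousOn_const.mul h.continuousOn_speed).integrableOn_Icc)
      (fun t ht => ?_)
    · simp only [hend, hstart, mul_one, mul_neg, Real.arcsin_neg, Finset.sum_const,
        Finset.card_univ, Fintype.card_fin, nsmul_eq_mul, intervalIntegral.integral_const_mul]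
        at this
      rw [curveLength]
      linarith
    · have ht' := Set.Ioo_subset_Icc_self ht
      refine HasDerivAt.hasDerivWithinAt (HasDerivAt.fun_sum fun j _ => ?_)
      have hx := (hbd t ht' j).1
      have hlt : (r * (U.col j ⬝ᵥ γ t *ᵥ U.col j)) ^ 2 < 1 := by
        rw [mul_pow]; nlinarith
      exact (Real.hasDerivAt_arcsin (fun e => by rw [e] at hlt; norm_num at hlt)
        (fun e => by rw [e] at hlt; norm_num at hlt)).comp t
        (((hder t ht' j).hasDerivAt (Icc_mem_nhds ht.1 ht.2)).const_mul r)
    · have ht' := Set.Ioo_subset_Icc_self ht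
      rw [h.soMetric_velocity ht']
      refine (Finset.sum_le_sum fun j _ => (hbd t ht' j).2).trans ?_
      simpa using sum_sqrt_le_speed hU (velocity γ t)
  -- Let `r` tend to `1`.
  have hlim : 2 * m * Real.arcsin 1 ≤ √(2 * m) * curveLength γ :=
    le_of_tendsto (f := fun r : ℝ => 2 * m * Real.arcsin r) (x := nhdsWithin 1 (Set.Iio 1))
      ((continuous_const.mul Real.continuous_arcsin).continuousWithinAt)
      (Filter.mem_of_superset (Ico_mem_nhdsLT zero_lt_one) key)
  rw [Real.arcsin_one] at hlim
  rcases Nat.eq_zero_or_pos m with rfl | hm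
  · simpa using curveLength_nonneg γ
  · have hm' : (0 : ℝ) < m := by exact_mod_cast hm
    have hs : √(2 * m) * √(m / 2) = (m : ℝ) := by
      rw [← Real.sqrt_mul (by positivity), show (2 * m * (m / 2) : ℝ) = m ^ 2 by ring,
        Real.sqrt_sq hm'.le]
    refine le_of_mul_le_mul_left ?_ (Real.sqrt_pos.2 (by positivity : (0 : ℝ) < 2 * m))
    calc √(2 * m) * (Real.pi * √(m / 2)) = Real.pi * (√(2 * m) * √(m / 2)) := by ring
      _ = 2 * m * (Real.pi / 2) := by rw [hs]; ring
      _ ≤ _ := hlim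

/-! ### Products of two reflections and principal angles -/

/-- The reflection `1 - 2 U Uᵀ`. If the columns of `U` are orthonormal, it is `-1` on their span
and `1` on the orthogonal complement. -/
noncomputable def frameReflection {n m : Type*} [DecidableEq n] [Fintype m]
    (U : Matrix n m ℝ) : Matrix n n ℝ :=
  1 - (2 : ℝ) • (U * Uᵀ)

theorem frameReflection_transpose {n m : Type*} [DecidableEq n] [Fintype m] (U : Matrix n m ℝ) :
    (frameReflection U)ᵀ = frameReflection U := by
  simp [frameReflection]

section Frame

variable {n m : Type*} [Fintype n] [Fintype m] [DecidableEq m] {U : Matrix n m ℝ}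

theorem frameReflection_mul_self [DecidableEq n] (hU : Uᵀ * U = 1) :
    frameReflection U * frameReflection U = 1 := by
  have h : U * Uᵀ * (U * Uᵀ) = U * Uᵀ := by
    rw [Matrix.mul_assoc, ← Matrix.mul_assoc Uᵀ, hU, Matrix.one_mul]
  simp only [frameReflection, Matrix.sub_mul, Matrix.mul_sub, Matrix.one_mul, Matrix.mul_one,
    Matrix.smul_mul, Matrix.mul_smul, h]
  module

theorem det_frameReflection [DecidableEq n] (hU : Uᵀ * U = 1) :
    (frameReflection U).det = (-1) ^ Fintype.card m := by
  rw [frameReflection, ← Matrix.smul_mul, det_one_sub_mul_comm, Matrix.mul_smul, hU,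
    show (1 : Matrix m m ℝ) - (2 : ℝ) • 1 = -1 by module, det_neg, det_one, mul_one]

theorem frameReflection_mul_mem [DecidableEq n] {m' : Type*} [Fintype m'] [DecidableEq m']
    {V : Matrix n m' ℝ} (hU : Uᵀ * U = 1) (hV : Vᵀ * V = 1)
    (hcard : Fintype.card m = Fintype.card m') :
    frameReflection U * frameReflection V ∈ specialOrthogonalGroup n ℝ := by
  refine mem_specialOrthogonalGroup_iff.mpr ⟨(mem_orthogonalGroup_iff n ℝ).mpr ?_, ?_⟩
  · rw [transpose_mul, frameReflection_transpose, frameReflection_transpose, Matrix.mul_assoc,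
      ← Matrix.mul_assoc (frameReflection V), frameReflection_mul_self hV, Matrix.one_mul,
      frameReflection_mul_self hU]
  · rw [det_mul, det_frameReflection hU, det_frameReflection hV, hcard, ← mul_pow]
    simp

/-- The Gram matrix of two combinations of `U` and `W`, where the columns of `U` are orthonormal and
those of `W` are orthogonal to each other and to `U`. -/
theorem combination_transpose_mul {U W : Matrix n m ℝ} {e : m → ℝ} (hU : Uᵀ * U = 1)
    (hUW : Uᵀ * W = 0) (hW : Wᵀ * W = diagonal e) (a b a' b' : m → ℝ) :
    (U * diagonal a + W * diagonal b)ᵀ * (U * diagonal a' + W * diagonal b')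
      = diagonal fun i => a i * a' i + b i * e i * b' i := by
  have hWU : Wᵀ * U = 0 := by
    rw [← transpose_transpose U, ← transpose_mul, hUW, transpose_zero]
  rw [transpose_add, transpose_mul, transpose_mul, Matrix.add_mul, Matrix.mul_add, Matrix.mul_add]
  simp only [diagonal_transpose, Matrix.mul_assoc]
  rw [← Matrix.mul_assoc Uᵀ, ← Matrix.mul_assoc Uᵀ, ← Matrix.mul_assoc Wᵀ, ← Matrix.mul_assoc Wᵀ,
    hU, hUW, hWU, hW]
  simp only [Matrix.zero_mul, Matrix.mul_zero, Matrix.one_mul, diagonal_mul_diagonal, add_zero,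
    zero_add, diagonal_add]
  simp only [mul_assoc]

/-- The Gram matrix of the residual that `V` leaves after its columns are projected to the span of
those of `U`. -/
theorem residual_transpose_mul_self {U V : Matrix n m ℝ} {c : m → ℝ} (hU : Uᵀ * U = 1)
    (hV : Vᵀ * V = 1) (hUV : Uᵀ * V = diagonal c) :
    (V - U * diagonal c)ᵀ * (V - U * diagonal c) = diagonal fun i => 1 - c i ^ 2 := by
  have hVU : Vᵀ * U = diagonal c := by
    rw [← transpose_transpose U, ← transpose_mul, hUV, diagonal_transpose]
  rw [transpose_sub, transpose_mul, Matrix.sub_mul, Matrix.mul_sub, Matrix.mul_sub,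
    diagonal_transpose, hV, Matrix.mul_assoc, hUV, ← Matrix.mul_assoc Vᵀ, hVU, Matrix.mul_assoc,
    ← Matrix.mul_assoc Uᵀ, hU, Matrix.one_mul, sub_self, sub_zero, diagonal_mul_diagonal,
    ← diagonal_one, diagonal_sub]
  simp only [sq]

theorem sq_le_one_of_frames {U V : Matrix n m ℝ} {c : m → ℝ} (hU : Uᵀ * U = 1)
    (hV : Vᵀ * V = 1) (hUV : Uᵀ * V = diagonal c) (i : m) : c i ^ 2 ≤ 1 := by
  have h := congrFun (congrFun (residual_transpose_mul_self hU hV hUV) i) i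
  rw [diagonal_apply_eq] at h
  have : 0 ≤ ((V - U * diagonal c)ᵀ * (V - U * diagonal c)) i i :=
    Finset.sum_nonneg fun k _ => mul_self_nonneg _
  linarith

/-- The initial directions `W` of the Grassmannian geodesic from the span of `U` to that of `V`.
The `i`-th column of `W` is a unit vector if the principal angle `arccos (c i)` is positive and
vanishes otherwise, whence the numbers `e i`. -/
theorem exists_directions {U V : Matrix n m ℝ} {c : m → ℝ} (hU : Uᵀ * U = 1)
    (hV : Vᵀ * V = 1) (hUV : Uᵀ * V = diagonal c) (hc : ∀ i, 0 ≤ c i) :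
    ∃ (W : Matrix n m ℝ) (e : m → ℝ), Uᵀ * W = 0 ∧ Wᵀ * W = diagonal e ∧
      (∀ i, Real.arccos (c i) = 0 ∨ e i = 1) ∧
      V = U * diagonal (fun i => Real.cos (Real.arccos (c i))) +
        W * diagonal (fun i => Real.sin (Real.arccos (c i))) := by
  have hD := residual_transpose_mul_self hU hV hUV
  have hc1 := sq_le_one_of_frames hU hV hUV
  have hs : ∀ i, √(1 - c i ^ 2) * √(1 - c i ^ 2) = 1 - c i ^ 2 := fun i =>
    Real.mul_self_sqrt (sub_nonneg.2 (hc1 i))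
  -- The columns of the residual are divided by their norms; a zero column stays zero as `0⁻¹ = 0`.
  refine ⟨(V - U * diagonal c) * diagonal fun i => (√(1 - c i ^ 2))⁻¹,
    fun i => (√(1 - c i ^ 2))⁻¹ * ((1 - c i ^ 2) * (√(1 - c i ^ 2))⁻¹), ?_, ?_, ?_, ?_⟩
  · rw [← Matrix.mul_assoc, Matrix.mul_sub, hUV, ← Matrix.mul_assoc, hU, Matrix.one_mul, sub_self,
      Matrix.zero_mul]
  · rw [transpose_mul, diagonal_transpose, Matrix.mul_assoc, ← Matrix.mul_assoc _ _ (diagonal _),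
      hD, diagonal_mul_diagonal, diagonal_mul_diagonal]
  · intro i
    by_cases h : √(1 - c i ^ 2) = 0
    · left
      have := hs i
      rw [h, mul_zero] at this
      have : c i = 1 := by nlinarith [hc i]
      rw [this, Real.arccos_one]
    · right
      linear_combination -(√(1 - c i ^ 2))⁻¹ ^ 2 * hs i +
        ((√(1 - c i ^ 2))⁻¹ * √(1 - c i ^ 2) + 1) * inv_mul_cancel₀ h
  · ext k i
    have hcos : Real.cos (Real.arccos (c i)) = c i :=
      Real.cos_arccos (by nlinarith [hc1 i, hc i]) (by nlinarith [hc1 i, hc i])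
    simp only [Matrix.add_apply, Matrix.mul_diagonal, Matrix.sub_apply, Real.sin_arccos, hcos]
    by_cases h : √(1 - c i ^ 2) = 0
    · have h1 := congrFun (congrFun hD i) i
      rw [diagonal_apply_eq, ← hs i, h, mul_zero] at h1
      have h2 := mul_self_eq_zero.mp <| (Finset.sum_eq_zero_iff_of_nonneg
        fun _ _ => mul_self_nonneg _).mp h1 k (Finset.mem_univ k)
      rw [transpose_apply, Matrix.sub_apply, Matrix.mul_diagonal] at h2
      rw [h]
      linarith
    · field_simp
      ring

end Frame

/-! ### The curve along a Grassmannian geodesic -/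

section Geodesic

variable {p : ℕ} {m : Type*} [Fintype m] [DecidableEq m]

/-- The curve `F t` of orthonormal frames that starts at `U` in the direction `W`, its `i`-th vector
turning with the constant angular velocity `θ i`. -/
noncomputable def frameCurve (U W : Matrix (Fin p) m ℝ) (θ : m → ℝ) (t : ℝ) : Matrix (Fin p) m ℝ :=
  U * diagonal (fun i => Real.cos (t * θ i)) + W * diagonal (fun i => Real.sin (t * θ i))

/-- The derivative of `frameCurve` with respect to `t`. -/
noncomputable def frameCurveDeriv (U W : Matrix (Fin p) m ℝ) (θ : m → ℝ) (t : ℝ) :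
    Matrix (Fin p) m ℝ :=
  U * diagonal (fun i => -(Real.sin (t * θ i) * θ i)) +
    W * diagonal (fun i => Real.cos (t * θ i) * θ i)

section FrameCurve

variable {U W : Matrix (Fin p) m ℝ} {θ e : m → ℝ}

theorem hasDerivAt_frameCurve (U W : Matrix (Fin p) m ℝ) (θ : m → ℝ) (t : ℝ) (i : Fin p) (j : m) :
    HasDerivAt (fun s => frameCurve U W θ s i j) (frameCurveDeriv U W θ t i j) t := by
  simp only [frameCurve, frameCurveDeriv, Matrix.add_apply, Matrix.mul_diagonal]
  have h : HasDerivAt (fun s => s * θ j) (θ j) t := by simpa using (hasDerivAt_id t).mul_const (θ j)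
  have := (h.cos.const_mul (U i j)).add (h.sin.const_mul (W i j))
  exact this.congr_deriv (by ring)

theorem contDiff_frameCurve (U W : Matrix (Fin p) m ℝ) (θ : m → ℝ) (i : Fin p) (j : m) :
    ContDiff ℝ 1 fun t => frameCurve U W θ t i j := by
  simp only [frameCurve, Matrix.add_apply, Matrix.mul_diagonal]
  fun_prop

theorem frameCurve_transpose_mul_self (hU : Uᵀ * U = 1) (hUW : Uᵀ * W = 0)
    (hW : Wᵀ * W = diagonal e) (he : ∀ i, θ i = 0 ∨ e i = 1) (t : ℝ) :
    (frameCurve U W θ t)ᵀ * frameCurve U W θ t = 1 := by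
  rw [frameCurve, combination_transpose_mul hU hUW hW, ← diagonal_one]
  congr 1
  funext i
  rcases he i with h | h
  · simp [h]
  · rw [h, mul_one, ← sq, ← sq, Real.cos_sq_add_sin_sq]

theorem frameCurve_transpose_mul_deriv (hU : Uᵀ * U = 1) (hUW : Uᵀ * W = 0)
    (hW : Wᵀ * W = diagonal e) (he : ∀ i, θ i = 0 ∨ e i = 1) (t : ℝ) :
    (frameCurve U W θ t)ᵀ * frameCurveDeriv U W θ t = 0 := by
  rw [frameCurve, frameCurveDeriv, combination_transpose_mul hU hUW hW, ← diagonal_zero]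
  congr 1
  funext i
  rcases he i with h | h
  · simp [h]
  · rw [h]; ring

theorem frameCurveDeriv_transpose_mul_self (hU : Uᵀ * U = 1) (hUW : Uᵀ * W = 0)
    (hW : Wᵀ * W = diagonal e) (he : ∀ i, θ i = 0 ∨ e i = 1) (t : ℝ) :
    (frameCurveDeriv U W θ t)ᵀ * frameCurveDeriv U W θ t = diagonal fun i => θ i ^ 2 := by
  rw [frameCurveDeriv, combination_transpose_mul hU hUW hW]
  congr 1
  funext i
  rcases he i with h | h
  · simp [h]
  · rw [h]; linear_combination θ i ^ 2 * Real.sin_sq_add_cos_sq (t * θ i)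

/-- The squared length of the derivative of a curve `F Fᵀ` of projections, where `F` is a curve of
orthonormal frames that moves orthogonally to its own span. -/
theorem trace_projection_deriv {F F' : Matrix (Fin p) m ℝ} (hF : Fᵀ * F = 1)
    (hF' : Fᵀ * F' = 0) :
    trace ((F' * Fᵀ + F * F'ᵀ)ᵀ * (F' * Fᵀ + F * F'ᵀ)) = 2 * trace (F'ᵀ * F') := by
  have hF'' : F'ᵀ * F = 0 := by
    rw [← transpose_transpose F, ← transpose_mul, hF', transpose_zero]
  have h1 : (F' * Fᵀ + F * F'ᵀ)ᵀ * (F' * Fᵀ + F * F'ᵀ)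
      = F * (F'ᵀ * F') * Fᵀ + F' * F'ᵀ := by
    rw [transpose_add, transpose_mul, transpose_mul, transpose_transpose, transpose_transpose,
      Matrix.add_mul, Matrix.mul_add, Matrix.mul_add]
    simp only [Matrix.mul_assoc]
    rw [← Matrix.mul_assoc F'ᵀ F, ← Matrix.mul_assoc Fᵀ F', ← Matrix.mul_assoc Fᵀ F, hF, hF', hF'']
    simp
  rw [h1, trace_add, trace_mul_comm F', Matrix.trace_mul_cycle, hF, Matrix.one_mul]
  ring

/-- If `U` moves to `F 1` along `frameCurve`, the product of the reflections in the spans of `F t` and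
`F 1` moves in the rotation group from the given product to the identity, with the constant speed
`2 √(∑ θᵢ²)`. -/
theorem exists_curve_of_directions (hU : Uᵀ * U = 1) (hUW : Uᵀ * W = 0)
    (hW : Wᵀ * W = diagonal e) (he : ∀ i, θ i = 0 ∨ e i = 1) {S : SO p}
    (hS : S.1 = frameReflection U * frameReflection (frameCurve U W θ 1)) :
    ∃ γ, IsC1Curve S 1 γ ∧ curveLength γ = 2 * √(∑ i, θ i ^ 2) := by
  have hF := frameCurve_transpose_mul_self hU hUW hW he
  set B := frameReflection (frameCurve U W θ 1) with hB
  have hBB : B * B = 1 := frameReflection_mul_self (hF 1)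
  have hγ : IsC1Curve S 1 fun t => frameReflection (frameCurve U W θ t) * B :=
    { mem := fun t _ => frameReflection_mul_mem (hF t) (hF 1) rfl
      smooth := fun i j => by
        simp only [Matrix.mul_apply, frameReflection, Matrix.sub_apply, Matrix.smul_apply,
          smul_eq_mul, transpose_apply]
        refine ContDiff.contDiffOn (ContDiff.sum fun k _ => ContDiff.mul (contDiff_const.sub
          (contDiff_const.mul (ContDiff.sum fun l _ => ?_))) contDiff_const)
        exact (contDiff_frameCurve U W θ i l).mul (contDiff_frameCurve U W θ k l)
      start := by
        have : frameCurve U W θ 0 = U := by simp [frameCurve]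
        rw [this, hS]
      finish := hBB }
  refine ⟨_, hγ, ?_⟩
  have hspeed : ∀ t ∈ Set.uIcc (0 : ℝ) 1,
      √(soMetric (frameReflection (frameCurve U W θ t) * B)
        (velocity (fun t => frameReflection (frameCurve U W θ t) * B) t)
        (velocity (fun t => frameReflection (frameCurve U W θ t) * B) t))
      = 2 * √(∑ i, θ i ^ 2) := by
    intro t ht
    rw [Set.uIcc_of_le zero_le_one] at ht
    set F := frameCurve U W θ t
    set F' := frameCurveDeriv U W θ t
    have hvel : velocity (fun t => frameReflection (frameCurve U W θ t) * B) t
        = (-(2 : ℝ) • (F' * Fᵀ + F * F'ᵀ)) * B := by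
      ext i j
      have hP := hasDerivWithinAt_mul_apply (s := Set.Icc 0 1) (t := t)
        (A := frameCurve U W θ) (B := fun t => (frameCurve U W θ t)ᵀ) (A' := F') (B' := F'ᵀ)
        (fun i j => (hasDerivAt_frameCurve U W θ t i j).hasDerivWithinAt)
        (fun i j => (hasDerivAt_frameCurve U W θ t j i).hasDerivWithinAt)
      have hG : ∀ i j, HasDerivWithinAt (fun s => frameReflection (frameCurve U W θ s) i j)
          ((-(2 : ℝ) • (F' * Fᵀ + F * F'ᵀ)) i j) (Set.Icc 0 1) t := fun i j => by
        have := ((hP i j).const_mul 2).const_sub ((1 : Matrix (Fin p) (Fin p) ℝ) i j)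
        refine this.congr_deriv ?_
        simp only [Matrix.smul_apply, smul_eq_mul]
        ring
      have hGB := hasDerivWithinAt_mul_apply (B := fun _ => B) (B' := 0) hG
        (fun i j => hasDerivWithinAt_const t _ (B i j)) i j
      rw [Matrix.mul_zero, add_zero] at hGB
      exact (uniqueDiffOn_Icc zero_lt_one t ht).eq_deriv _
        (hγ.hasDerivWithinAt ht i j) hGB
    have hBt : Bᵀ = B := frameReflection_transpose _
    rw [hγ.soMetric_velocity ht, hvel, transpose_mul, Matrix.mul_assoc, trace_mul_comm,
      Matrix.mul_assoc, Matrix.mul_assoc, hBt, hBB, Matrix.mul_one, transpose_smul,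
      Matrix.smul_mul, Matrix.mul_smul, trace_smul, trace_smul,
      trace_projection_deriv (hF t) (frameCurve_transpose_mul_deriv hU hUW hW he t),
      frameCurveDeriv_transpose_mul_self hU hUW hW he t, trace_diagonal, smul_eq_mul, smul_eq_mul,
      show (1 / 2 * (-2 * (-2 * (2 * ∑ i, θ i ^ 2))) : ℝ) = 2 ^ 2 * ∑ i, θ i ^ 2 by ring,
      Real.sqrt_mul (by norm_num), Real.sqrt_sq zero_le_two]
  rw [curveLength, intervalIntegral.integral_congr hspeed]
  simp

end FrameCurve

/-- The product of the reflections in two subspaces of equal dimension with principal angles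
`θᵢ = arccos (c i)` is joined to the identity by a curve of length `2 √(∑ θᵢ²)`. The directions
of the curve exist because `θᵢ ≤ π / 2`, that is, `0 ≤ c i`. -/
theorem exists_curve_of_frames {U V : Matrix (Fin p) m ℝ} {c : m → ℝ} (hU : Uᵀ * U = 1)
    (hV : Vᵀ * V = 1) (hUV : Uᵀ * V = diagonal c) (hc : ∀ i, 0 ≤ c i) {S : SO p}
    (hS : S.1 = frameReflection U * frameReflection V) :
    ∃ γ, IsC1Curve S 1 γ ∧ curveLength γ = 2 * √(∑ i, Real.arccos (c i) ^ 2) := by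
  obtain ⟨W, e, hUW, hW, he, hVW⟩ := exists_directions hU hV hUV hc
  refine exists_curve_of_directions hU hUW hW he (hS.trans ?_)
  conv_lhs => rw [hVW]
  simp only [frameCurve, one_mul]

end Geodesic

/-- A reflection in a subspace of even dimension is joined to the identity: it is the product of the
reflections in two orthogonal subspaces of half the dimension. This keeps the infimum that defines
`dSO` from being the infimum of the empty set. -/
theorem exists_curve_of_even {p k : ℕ} {U : Matrix (Fin p) (Fin (k + k)) ℝ} (hU : Uᵀ * U = 1)
    {S : SO p} (hS : S.1 = frameReflection U) : ∃ γ, IsC1Curve S 1 γ := by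
  set U₁ : Matrix (Fin p) (Fin k) ℝ := U.submatrix id (Fin.castAdd k)
  set U₂ : Matrix (Fin p) (Fin k) ℝ := U.submatrix id (Fin.natAdd k)
  have hentry : ∀ i j, ∑ l, U l i * U l j = (1 : Matrix (Fin (k + k)) (Fin (k + k)) ℝ) i j :=
    fun i j => congrFun (congrFun hU i) j
  have h₁ : U₁ᵀ * U₁ = 1 := by
    ext i j
    refine (hentry _ _).trans ?_
    simp [Matrix.one_apply]
  have h₂ : U₂ᵀ * U₂ = 1 := by
    ext i j
    refine (hentry _ _).trans ?_
    simp [Matrix.one_apply]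
  have h₁₂ : U₁ᵀ * U₂ = 0 := by
    ext i j
    refine (hentry _ _).trans ?_
    rw [Matrix.one_apply_ne, Matrix.zero_apply]
    intro h
    have := congrArg Fin.val h
    simp only [Fin.val_castAdd, Fin.val_natAdd] at this
    omega
  have hsum : U * Uᵀ = U₁ * U₁ᵀ + U₂ * U₂ᵀ := by
    ext i j
    simp only [Matrix.mul_apply, Matrix.add_apply]
    exact Fin.sum_univ_add _
  have hS' : S.1 = frameReflection U₁ * frameReflection U₂ := by
    have h0 : U₁ * U₁ᵀ * (U₂ * U₂ᵀ) = 0 := by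
      rw [Matrix.mul_assoc, ← Matrix.mul_assoc U₁ᵀ, h₁₂, Matrix.zero_mul, Matrix.mul_zero]
    rw [hS]
    simp only [frameReflection, hsum, Matrix.sub_mul, Matrix.mul_sub, Matrix.one_mul,
      Matrix.mul_one, Matrix.smul_mul, Matrix.mul_smul, h0, smul_zero]
    module
  obtain ⟨γ, hγ, -⟩ := exists_curve_of_frames (c := fun _ => 0) h₁ h₂ (by rw [h₁₂, diagonal_zero])
    (fun _ => le_rfl) hS'
  exact ⟨γ, hγ⟩

/-! ### The upper bound for products of reflections -/

/-- Two subspaces whose principal angles are all `0` or `π / 2` have commuting projections. -/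
theorem commute_of_principalVectors {n m : Type*} [Fintype n] [Fintype m] [DecidableEq m]
    {U V : Matrix n m ℝ} {c : m → ℝ} (hU : Uᵀ * U = 1) (hV : Vᵀ * V = 1) (hUV : Uᵀ * V = diagonal c)
    (hc : ∀ i, c i = 0 ∨ c i = 1) : Commute (U * Uᵀ) (V * Vᵀ) := by
  have hVU : Vᵀ * U = diagonal c := by
    rw [← transpose_transpose U, ← transpose_mul, hUV, diagonal_transpose]
  have hcc : diagonal c * diagonal c = diagonal c := by
    rw [diagonal_mul_diagonal]
    congr 1
    funext i
    rcases hc i with h | h <;> simp [h]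
  have hD : (V - U * diagonal c) * diagonal c = 0 := by
    rw [← conjTranspose_mul_self_eq_zero, conjTranspose_eq_transpose_of_trivial,
      transpose_mul, Matrix.mul_assoc,
      ← Matrix.mul_assoc _ _ (diagonal c), residual_transpose_mul_self hU hV hUV,
      diagonal_transpose, diagonal_mul_diagonal, diagonal_mul_diagonal, ← diagonal_zero]
    congr 1
    funext i
    rcases hc i with h | h <;> simp [h]
  have hVc : V * diagonal c = U * diagonal c := by
    rwa [Matrix.sub_mul, Matrix.mul_assoc, hcc, sub_eq_zero] at hD
  have h1 : U * Uᵀ * (V * Vᵀ) = U * diagonal c * Uᵀ := by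
    have := congrArg Matrix.transpose hVc
    rw [transpose_mul, transpose_mul, diagonal_transpose] at this
    rw [Matrix.mul_assoc, ← Matrix.mul_assoc Uᵀ, hUV, this, Matrix.mul_assoc]
  have h2 : V * Vᵀ * (U * Uᵀ) = U * diagonal c * Uᵀ := by
    rw [Matrix.mul_assoc, ← Matrix.mul_assoc Vᵀ, hVU, ← Matrix.mul_assoc, hVc]
  exact h1.trans h2.symm

/-- Jordan's inequality `2 θ ≤ π sin θ` for `θ = arccos x`, squared. -/
theorem four_mul_arccos_sq_le {x : ℝ} (h0 : 0 ≤ x) (h1 : x ≤ 1) :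
    4 * Real.arccos x ^ 2 ≤ Real.pi ^ 2 * (1 - x ^ 2) := by
  have h := Real.mul_le_sin (Real.arccos_nonneg x) (Real.arccos_le_pi_div_two.2 h0)
  have hc := Real.cos_arccos (by linarith) h1
  have hp := Real.pi_pos
  rw [div_mul_eq_mul_div, div_le_iff₀ hp] at h
  have h2 := pow_le_pow_left₀ (by have := Real.arccos_nonneg x; positivity) h 2
  rw [mul_pow, mul_pow, Real.sin_sq, hc] at h2
  linarith

theorem four_mul_arccos_sq_lt {x : ℝ} (h0 : 0 < x) (h1 : x < 1) :
    4 * Real.arccos x ^ 2 < Real.pi ^ 2 * (1 - x ^ 2) := by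
  have h := Real.mul_lt_sin (Real.arccos_pos.2 h1) (Real.arccos_lt_pi_div_two.2 h0)
  have hc := Real.cos_arccos (by linarith) h1.le
  have hp := Real.pi_pos
  rw [div_mul_eq_mul_div, div_lt_iff₀ hp] at h
  have h2 := pow_lt_pow_left₀ h (by have := Real.arccos_nonneg x; positivity) two_ne_zero
  rw [mul_pow, mul_pow, Real.sin_sq, hc] at h2
  linarith

/-- Upper bound for the distance of a product of two reflections from the identity, in terms of
`tr (P Q) = ∑ cos² θᵢ`. It is strict either because `tr (P Q)` exceeds `m / 2`, or because some
principal angle lies strictly between `0` and `π / 2`, where Jordan's inequality is strict. -/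
theorem dSO_mul_lt {p : ℕ} {P Q : Matrix (Fin p) (Fin p) ℝ} (hP : Pᵀ = P) (hP' : P * P = P)
    (hQ : Qᵀ = Q) (hQ' : Q * Q = Q) {m : ℕ} (hPm : P.rank = m) (hQm : Q.rank = m)
    (hle : (m : ℝ) / 2 ≤ trace (P * Q)) (hcomm : trace (P * Q) = m / 2 → ¬ Commute P Q) {S : SO p}
    (hS : S.1 = (1 - (2 : ℝ) • P) * (1 - (2 : ℝ) • Q)) : dSO S 1 < Real.pi * √(m / 2) := by
  obtain ⟨U, V, c, hU, rfl, hV, rfl, hc, hUV⟩ := exists_principalVectors hP hP' hQ hQ' hPm hQm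
  have hc1 : ∀ i, c i ≤ 1 := fun i => by nlinarith [hc i, sq_le_one_of_frames hU hV hUV i]
  have htr : trace (U * Uᵀ * (V * Vᵀ)) = ∑ i, c i ^ 2 := by
    have hVU : Vᵀ * U = diagonal c := by
      rw [← transpose_transpose U, ← transpose_mul, hUV, diagonal_transpose]
    rw [Matrix.mul_assoc, trace_mul_comm, ← Matrix.mul_assoc Uᵀ, hUV, Matrix.mul_assoc, hVU,
      diagonal_mul_diagonal, trace_diagonal]
    simp only [sq]
  rw [htr] at hle hcomm
  have hbd : ∑ i, Real.pi ^ 2 * (1 - c i ^ 2) = Real.pi ^ 2 * (m - ∑ i, c i ^ 2) := by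
    rw [← Finset.mul_sum, Finset.sum_sub_distrib]
    simp
  have hp := Real.pi_pos
  have key : ∑ i, 4 * Real.arccos (c i) ^ 2 < Real.pi ^ 2 * (m / 2) := by
    rcases hle.lt_or_eq with hlt | heq
    · refine (Finset.sum_le_sum fun i _ => four_mul_arccos_sq_le (hc i) (hc1 i)).trans_lt ?_
      rw [hbd]
      gcongr
      linarith
    · obtain ⟨i, hi⟩ : ∃ i, ¬ (c i = 0 ∨ c i = 1) := by
        by_contra! h
        exact hcomm heq.symm (commute_of_principalVectors hU hV hUV h)
      push Not at hi
      refine (Finset.sum_lt_sum (fun i _ => four_mul_arccos_sq_le (hc i) (hc1 i))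
        ⟨i, Finset.mem_univ i, four_mul_arccos_sq_lt ((hc i).lt_of_ne' hi.1)
          ((hc1 i).lt_of_ne hi.2)⟩).trans_le ?_
      rw [hbd, ← heq]
      exact le_of_eq (by ring)
  obtain ⟨γ, hγ, hlen⟩ := exists_curve_of_frames hU hV hUV hc (S := S) hS
  refine (dSO_le_curveLength hγ).trans_lt ?_
  rw [← Finset.mul_sum] at key
  have h := Real.sqrt_lt_sqrt (by positivity) key
  rwa [Real.sqrt_mul (by positivity), Real.sqrt_mul (by positivity), Real.sqrt_sq hp.le,
    show (4 : ℝ) = 2 ^ 2 by norm_num, Real.sqrt_sq zero_le_two, ← hlen] at h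

/-! ### Coordinate projections -/

/-- The orthogonal projection to the coordinate subspace spanned by the `e i` with `i ∈ s`. -/
def coordProj {n : Type*} [DecidableEq n] (s : Finset n) : Matrix n n ℝ :=
  diagonal fun i => if i ∈ s then 1 else 0

theorem coordProj_transpose {n : Type*} [DecidableEq n] (s : Finset n) :
    (coordProj s)ᵀ = coordProj s :=
  diagonal_transpose _

section Projection

variable {n : Type*} [Fintype n] [DecidableEq n]

theorem coordProj_mul_self (s : Finset n) : coordProj s * coordProj s = coordProj s := by
  simp [coordProj, diagonal_mul_diagonal]

theorem rank_coordProj (s : Finset n) : (coordProj s).rank = s.card := by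
  rw [coordProj, rank_diagonal, Fintype.card_subtype]
  congr 1
  ext i
  simp

theorem trace_mul_coordProj (P : Matrix n n ℝ) (s : Finset n) :
    trace (P * coordProj s) = ∑ i ∈ s, P i i := by
  simp [coordProj, trace, Matrix.mul_diagonal, Finset.sum_ite_mem]

theorem trace_eq_rank_of_projection {P : Matrix n n ℝ} (hsymm : Pᵀ = P) (hidem : P * P = P) :
    trace P = P.rank := by
  obtain ⟨U, hU, hUP⟩ := exists_frame_of_projection hsymm hidem rfl
  conv_lhs => rw [← hUP]
  rw [trace_mul_comm, hU]
  simp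

/-- If a projection of rank `m ≥ n / 2` commutes with all coordinate projections of rank `m`, it is
diagonal, hence is itself one of them; this rules out that `tr (P * coordProj s)` is `m / 2`, its
mean value in the extreme case `n = 2 m`, for every `s`. -/
theorem exists_coordProj {P : Matrix n n ℝ} (hsymm : Pᵀ = P) (hidem : P * P = P) {m : ℕ}
    (hrank : P.rank = m) (hm : 0 < m) (hn : Fintype.card n ≤ 2 * m) :
    ∃ s : Finset n, s.card = m ∧ (m : ℝ) / 2 ≤ trace (P * coordProj s) ∧
      (trace (P * coordProj s) = m / 2 → ¬ Commute P (coordProj s)) := by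
  have hm' : (0 : ℝ) < m := by exact_mod_cast hm
  have htr : ∑ i, P i i = m := by
    rw [← hrank]
    exact trace_eq_rank_of_projection hsymm hidem
  have hmn : m ≤ Fintype.card n := hrank ▸ P.rank_le_card_width
  have hentry : ∀ i j, P i j = P j i := fun i j => congrFun (congrFun hsymm j) i
  have hdiag : ∀ i, P i i = ∑ j, P i j ^ 2 := fun i => by
    conv_lhs => rw [← hidem, Matrix.mul_apply]
    exact Finset.sum_congr rfl fun j _ => by rw [hentry j i, sq]
  have hnn : ∀ i, 0 ≤ P i i := fun i => by
    rw [hdiag]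
    exact Finset.sum_nonneg fun j _ => sq_nonneg _
  simp only [trace_mul_coordProj]
  by_contra! hcon
  have hle : ∀ s : Finset n, s.card = m → ∑ i ∈ s, P i i ≤ m / 2 := fun s hs => by
    by_contra! h
    exact h.ne' (hcon s hs h.le).1
  have heq : ∀ s : Finset n, s.card = m → ∑ i ∈ s, P i i = m / 2 := by
    intro s hs
    -- The complement of `s` has at most `m` elements; enlarge it to a set of size `m`.
    obtain ⟨s', hss', -, hs'⟩ := Finset.exists_subsuperset_card_eq (s := sᶜ)
      (Finset.subset_univ _) (n := m) (by rw [Finset.card_compl]; omega) (by simpa using hmn)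
    have h1 : ∑ i ∈ sᶜ, P i i ≤ ∑ i ∈ s', P i i :=
      Finset.sum_le_sum_of_subset_of_nonneg hss' fun i _ _ => hnn i
    have h2 := Finset.sum_add_sum_compl s fun i => P i i
    linarith [hle s hs, hle s' hs']
  have hcomm : ∀ s : Finset n, s.card = m → Commute P (coordProj s) := fun s hs =>
    (hcon s hs (heq s hs).ge).2
  rcases hmn.eq_or_lt with h | hlt
  · have := heq Finset.univ (by simpa using h.symm)
    linarith
  have hoff : ∀ i j, i ≠ j → P i j = 0 := by
    intro i j hij
    obtain ⟨s, his, hsj, hs⟩ := Finset.exists_subsuperset_card_eq (s := {i}) (t := {j}ᶜ) (n := m)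
      (by simpa using hij.symm) (by simpa using Nat.succ_le_of_lt hm)
      (by rw [Finset.card_compl]; simp; omega)
    have hi : i ∈ s := his (Finset.mem_singleton_self i)
    have hj : j ∉ s := fun h => by simpa using hsj h
    have := congrFun (congrFun (hcomm s hs).eq i) j
    simpa [coordProj, Matrix.mul_diagonal, Matrix.diagonal_mul, hi, hj] using this.symm
  have h01 : ∀ i, P i i = 0 ∨ P i i = 1 := by
    intro i
    have h := hdiag i
    rw [Finset.sum_eq_single i (fun j _ hj => by rw [hoff i j hj.symm]; simp) (by simp)] at h
    have : P i i * (P i i - 1) = 0 := by linear_combination -h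
    rcases mul_eq_zero.mp this with h | h
    · exact Or.inl h
    · exact Or.inr (by linarith)
  have hones : ∑ i ∈ Finset.univ.filter fun i => P i i = 1, P i i = m := by
    rw [← htr, Finset.sum_filter]
    refine Finset.sum_congr rfl fun i _ => ?_
    rcases h01 i with h | h <;> simp [h]
  have hcard : (Finset.univ.filter fun i => P i i = 1).card = m := by
    rw [Finset.sum_congr rfl fun i hi => (Finset.mem_filter.mp hi).2] at hones
    simpa using hones
  linarith [heq _ hcard]

end Projection

/-! ### Involutions -/

section Involution

variable {p : ℕ}

/-- The orthogonal projection `(1 - R) / 2` to the `(-1)`-eigenspace of an involution `R`. -/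
noncomputable def negProj (R : SO p) : Matrix (Fin p) (Fin p) ℝ := (1 / 2 : ℝ) • (1 - R.1)

theorem coe_eq_one_sub_negProj (R : SO p) : R.1 = 1 - (2 : ℝ) • negProj R := by
  rw [negProj]
  module

theorem SO.transpose_mul_self (R : SO p) : R.1ᵀ * R.1 = 1 :=
  (mem_orthogonalGroup_iff' (Fin p) ℝ).mp (mem_specialOrthogonalGroup_iff.mp R.2).1

namespace IsInvolution

variable {R : SO p}

theorem coe_mul_self (hR : IsInvolution R) : R.1 * R.1 = 1 :=
  congrArg Subtype.val hR.1

theorem negProj_transpose (hR : IsInvolution R) : (negProj R)ᵀ = negProj R := by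
  have : R.1ᵀ = R.1 := by
    calc R.1ᵀ = R.1ᵀ * (R.1 * R.1) := by rw [hR.coe_mul_self, Matrix.mul_one]
      _ = R.1 := by rw [← Matrix.mul_assoc, R.transpose_mul_self, Matrix.one_mul]
  rw [negProj, transpose_smul, transpose_sub, transpose_one, this]

theorem negProj_mul_self (hR : IsInvolution R) : negProj R * negProj R = negProj R := by
  simp only [negProj, Matrix.smul_mul, Matrix.mul_smul, Matrix.sub_mul, Matrix.mul_sub,
    Matrix.one_mul, Matrix.mul_one, hR.coe_mul_self]
  module

theorem rank_negProj (hR : IsInvolution R) : (negProj R).rank = level R := by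
  suffices h : (negProj R).mulVecLin.range = Module.End.eigenspace (toLin' R.1) (-1) by
    rw [Matrix.rank, h, level]
  ext x
  rw [Module.End.mem_eigenspace_iff, Matrix.toLin'_apply, LinearMap.mem_range, neg_one_smul]
  constructor
  · rintro ⟨y, rfl⟩
    rw [mulVecLin_apply, mulVec_mulVec, ← neg_mulVec]
    congr 1
    rw [negProj, Matrix.mul_smul, Matrix.mul_sub, hR.coe_mul_self, Matrix.mul_one]
    module
  · intro hx
    refine ⟨x, ?_⟩
    rw [mulVecLin_apply, negProj, smul_mulVec, sub_mulVec, one_mulVec, hx]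
    module

theorem exists_frame (hR : IsInvolution R) :
    ∃ U : Matrix (Fin p) (Fin (level R)) ℝ, Uᵀ * U = 1 ∧ R.1 = frameReflection U := by
  obtain ⟨U, hU, hUP⟩ :=
    exists_frame_of_projection hR.negProj_transpose hR.negProj_mul_self hR.rank_negProj
  exact ⟨U, hU, by rw [frameReflection, hUP, ← coe_eq_one_sub_negProj]⟩

theorem level_pos (hR : IsInvolution R) : 0 < level R := by
  obtain ⟨U, -, hRU⟩ := hR.exists_frame
  refine Nat.pos_of_ne_zero fun h => hR.2 (Subtype.ext ?_)
  have : IsEmpty (Fin (level R)) := by rw [h]; infer_instance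
  have hUU : U * Uᵀ = 0 := by
    ext i j
    rw [Matrix.mul_apply, Finset.univ_eq_empty, Finset.sum_empty, Matrix.zero_apply]
  rw [hRU, frameReflection, hUU, smul_zero, sub_zero]
  rfl

/-- The level is even because `det R = (-1) ^ level R`. -/
theorem even_level (hR : IsInvolution R) : Even (level R) := by
  obtain ⟨U, hU, hRU⟩ := hR.exists_frame
  have h := (mem_specialOrthogonalGroup_iff.mp R.2).2
  rw [hRU, det_frameReflection hU, Fintype.card_fin] at h
  by_contra hodd
  rw [(Nat.not_even_iff_odd.mp hodd).neg_one_pow] at h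
  norm_num at h

/-- An involution of level `m` has distance at least `π √(m / 2)` from the identity. -/
theorem le_dSO (hR : IsInvolution R) : Real.pi * √(level R / 2) ≤ dSO R 1 := by
  obtain ⟨U, hU, hRU⟩ := hR.exists_frame
  obtain ⟨γ, hγ⟩ : ∃ γ, IsC1Curve R 1 γ := by
    obtain ⟨k, hk⟩ := hR.even_level
    generalize level R = m at U hk
    subst hk
    exact exists_curve_of_even hU hRU
  refine le_csInf ⟨_, γ, hγ, rfl⟩ ?_
  rintro _ ⟨γ, hγ, rfl⟩
  refine pi_mul_sqrt_le_curveLength hγ hU ?_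
  rw [hRU, frameReflection, Matrix.sub_mul, Matrix.smul_mul, Matrix.mul_assoc, hU, Matrix.mul_one,
    Matrix.one_mul]
  module

end IsInvolution

end Involution

/-! ### Sign changes -/

section SignOf

variable {p : ℕ}

/-- The sign change that is `-1` exactly on `s`. -/
def signOf (s : Finset (Fin p)) (i : Fin p) : ℤˣ := if i ∈ s then -1 else 1

theorem signMatrix_signOf (s : Finset (Fin p)) :
    signMatrix (signOf s) = 1 - (2 : ℝ) • coordProj s := by
  rw [signMatrix, coordProj, ← diagonal_one, ← diagonal_smul, diagonal_sub]
  congr 1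
  funext i
  by_cases h : i ∈ s <;> simp [signOf, h]
  norm_num

theorem signLevel_signOf (s : Finset (Fin p)) : signLevel (signOf s) = s.card := by
  rw [signLevel]
  congr 1
  ext i
  by_cases h : i ∈ s <;> simp [signOf, h]

theorem isEven_signOf {s : Finset (Fin p)} (hs : Even s.card) : IsEven (signOf s) := by
  obtain ⟨U, hU, hUs⟩ := exists_frame_of_projection (coordProj_transpose s) (coordProj_mul_self s)
    (rank_coordProj s)
  have hU' : signMatrix (signOf s) = frameReflection U := by
    rw [signMatrix_signOf, frameReflection, hUs]
  rw [IsEven, hU', mem_specialOrthogonalGroup_iff, mem_orthogonalGroup_iff,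
    frameReflection_transpose, frameReflection_mul_self hU, det_frameReflection hU,
    Fintype.card_fin, hs.neg_one_pow]
  exact ⟨rfl, rfl⟩

end SignOf

end SignChange

open SignChange in
theorem mainTheorem8 (p : ℕ) (R : SignChange.SO p) (hR : SignChange.IsInvolution R)
    (hlevel : (p : ℝ) / 2 ≤ (SignChange.level R : ℝ)) :
    ∃ σ : SignChange.EvenSignChange p, SignChange.signLevel σ.1 = SignChange.level R ∧
      SignChange.dSO (R * SignChange.signSO σ) 1 < SignChange.dSO R 1 := by
  have hp : Fintype.card (Fin p) ≤ 2 * level R := by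
    rw [Fintype.card_fin]
    have : (p : ℝ) ≤ 2 * level R := by linarith
    exact_mod_cast this
  obtain ⟨s, hs, hle, hcomm⟩ := exists_coordProj hR.negProj_transpose hR.negProj_mul_self
    hR.rank_negProj hR.level_pos hp
  refine ⟨⟨signOf s, isEven_signOf (hs ▸ hR.even_level)⟩, (signLevel_signOf s).trans hs, ?_⟩
  refine lt_of_lt_of_le (dSO_mul_lt hR.negProj_transpose hR.negProj_mul_self
    (coordProj_transpose s) (coordProj_mul_self s) hR.rank_negProj
    ((rank_coordProj s).trans hs) hle hcomm ?_) hR.le_dSO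
  change R.1 * signMatrix (signOf s) = _
  rw [signMatrix_signOf, ← coe_eq_one_sub_negProj]
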